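/- Let $n,N\ge 1$, let $D\subset\mathbb R^n$ be a bounded set, and let $\Omega\in L^2(\mathbb R^n,\mathbb R^{N\times N})$. For $s\ge 0$ and real-valued $f\in L^2(\mathbb R^n)$ define $\Delta^{s/2}f$ by $(\Delta^{s/2}f)^\wedge(\xi)=(2\pi|\xi|)^s f^\wedge(\xi)$, where $f^\wedge(\xi)=\int f(x)e^{-2\pi i x\cdot\xi}\,dx$, and let $H^s(\mathbb R^n)=\{f\in L^2(\mathbb R^n):\Delta^{s/2}f\in L^2(\mathbb R^n)\}$; for matrix-valued maps these notions are understood entrywise. Let $$H^{n/2}_I(D,SO(N))=\{Q:\mathbb R^n\to\mathbb R^{N\times N}:\ Q-I\in H^{n/2}(\mathbb R^n,\mathbb R^{N\times N}),\ \operatorname{supp}(Q-I)\subset\overline D,\ Q\in SO(N)\text{ a.e.}\},$$ and for $Q$ in this class let $$E(Q)=\int_{\mathbb R^n}\bigl|Q\,\Delta^{n/4}(Q^T-I)+Q\,\Omega\,Q^T\bigr|^2,\qquad |A|^2=\sum_{i,j}A_{ij}^2 .$$ Then there exists $P\in H^{n/2}_I(D,SO(N))$ such that $E(P)\le E(Q)$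 for every $Q\in H^{n/2}_I(D,SO(N))$. Moreover, every such minimizer $P$ satisfies $$\|\Delta^{n/4}(P-I)\|_{2,\mathbb R^n}\le 2\,\|\Omega\|_{2,\mathbb R^n}.$$ -/

import Mathlib

open MeasureTheory FourierTransform
open scoped ENNReal

noncomputable section

namespace FracGauge

/-- The class in `L²(ℝⁿ; ℂ)` of a square integrable real valued function. -/
def toL2 {n : ℕ} (f : EuclideanSpace ℝ (Fin n) → ℝ) (hf : MemLp f 2 volume) :
    Lp (α := EuclideanSpace ℝ (Fin n)) ℂ 2 volume :=
  (hf.ofReal (K := ℂ)).toLp (fun x => (f x : ℂ))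

/-- `g = Δ^{s/2} f` with `f, g ∈ L²(ℝⁿ)`: the `L²` Fourier transforms (kernel `e^{-2πi x·ξ}`)
satisfy `ĝ(ξ) = (2π|ξ|)^s f̂(ξ)` for almost every `ξ`. -/
def HasFracLaplacian {n : ℕ} (s : ℝ) (f g : EuclideanSpace ℝ (Fin n) → ℝ) : Prop :=
  ∃ (hf : MemLp f 2 volume) (hg : MemLp g 2 volume),
    ∀ᵐ ξ : EuclideanSpace ℝ (Fin n),
      (𝓕 (toL2 g hg)) ξ = (((2 * Real.pi * ‖ξ‖) ^ s : ℝ) : ℂ) * (𝓕 (toL2 f hf)) ξ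

/-- `f ∈ H^s(ℝⁿ)`: both `f` and `Δ^{s/2} f` belong to `L²(ℝⁿ)`. Since the symbol is even and
real, `Δ^{s/2} f` is real valued for real valued `f`. -/
def MemH {n : ℕ} (s : ℝ) (f : EuclideanSpace ℝ (Fin n) → ℝ) : Prop :=
  ∃ g : EuclideanSpace ℝ (Fin n) → ℝ, HasFracLaplacian s f g

/-- `Δ^{s/2} f` for `f ∈ H^s(ℝⁿ)` (unique up to null sets, see `HasFracLaplacian.ae_unique`);
the value `0` is used outside `H^s(ℝⁿ)`. -/
def fracLaplacian {n : ℕ} (s : ℝ) (f : EuclideanSpace ℝ (Fin n) → ℝ) :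
    EuclideanSpace ℝ (Fin n) → ℝ :=
  open Classical in if h : MemH s f then h.choose else 0

theorem MemH.hasFracLaplacian {n : ℕ} {s : ℝ} {f : EuclideanSpace ℝ (Fin n) → ℝ}
    (h : MemH s f) : HasFracLaplacian s f (fracLaplacian s f) := by
  rw [fracLaplacian, dif_pos h]
  exact h.choose_spec

theorem HasFracLaplacian.ae_unique {n : ℕ} {s : ℝ} {f g₁ g₂ : EuclideanSpace ℝ (Fin n) → ℝ}
    (h₁ : HasFracLaplacian s f g₁) (h₂ : HasFracLaplacian s f g₂) : g₁ =ᵐ[volume] g₂ := by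
  obtain ⟨hf, hg₁, e₁⟩ := h₁
  obtain ⟨_, hg₂, e₂⟩ := h₂
  have hF : 𝓕 (toL2 g₁ hg₁) = 𝓕 (toL2 g₂ hg₂) := by
    apply Lp.ext
    filter_upwards [e₁, e₂] with ξ h1 h2
    rw [h1, h2]
  have hL : toL2 g₁ hg₁ = toL2 g₂ hg₂ :=
    (Lp.fourierTransformₗᵢ (EuclideanSpace ℝ (Fin n)) ℂ).injective hF
  have := (MemLp.toLp_eq_toLp_iff _ _).1 hL
  filter_upwards [this] with x hx
  exact_mod_cast hx

/-- `Δ^{s/2}` applied to each entry of a matrix valued map. -/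
def matFracLaplacian {n N : ℕ} (s : ℝ)
    (A : EuclideanSpace ℝ (Fin n) → Matrix (Fin N) (Fin N) ℝ) :
    EuclideanSpace ℝ (Fin n) → Matrix (Fin N) (Fin N) ℝ :=
  fun x => Matrix.of fun i j => fracLaplacian s (fun y => A y i j) x

/-- `∫_{ℝⁿ} |A|²` in `[0, ∞]`, where `|A|² = A : A = ∑ A_{ij}²`. -/
def matL2NormSq {n N : ℕ} (A : EuclideanSpace ℝ (Fin n) → Matrix (Fin N) (Fin N) ℝ) : ℝ≥0∞ :=
  ∫⁻ x, ENNReal.ofReal (∑ i, ∑ j, A x i j ^ 2)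

/-- The norm `‖A‖₂` in `[0, ∞]`. -/
def matL2Norm {n N : ℕ} (A : EuclideanSpace ℝ (Fin n) → Matrix (Fin N) (Fin N) ℝ) : ℝ≥0∞ :=
  matL2NormSq A ^ (1 / 2 : ℝ)

/-- `Q ∈ H^{n/2}_I(D, SO(N))`: the entries of `Q - I` lie in `H^{n/2}(ℝⁿ)`, the (essential)
support of `Q - I` is contained in the closure of `D`, and `Q ∈ SO(N)` almost everywhere. -/
structure Admissible {n N : ℕ} (D : Set (EuclideanSpace ℝ (Fin n)))
    (Q : EuclideanSpace ℝ (Fin n) → Matrix (Fin N) (Fin N) ℝ) : Prop where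
  memH : ∀ i j, MemH ((n : ℝ) / 2) (fun x => (Q x - 1) i j)
  support : ∀ᵐ x, x ∉ closure D → Q x - 1 = 0
  mem_SO : ∀ᵐ x, Q x ∈ Matrix.specialOrthogonalGroup (Fin N) ℝ

/-- `Ω_Q = Q Δ^{n/4}(Qᵀ - I) + Q Ω Qᵀ`. -/
def gauged {n N : ℕ} (Ω Q : EuclideanSpace ℝ (Fin n) → Matrix (Fin N) (Fin N) ℝ) :
    EuclideanSpace ℝ (Fin n) → Matrix (Fin N) (Fin N) ℝ :=
  fun x => Q x * matFracLaplacian ((n : ℝ) / 2) (fun y => (Q y).transpose - 1) x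
    + Q x * Ω x * (Q x).transpose

/-- `E(Q) = ‖Ω_Q‖₂²`. -/
def energy {n N : ℕ} (Ω Q : EuclideanSpace ℝ (Fin n) → Matrix (Fin N) (Fin N) ℝ) : ℝ≥0∞ :=
  matL2NormSq (gauged Ω Q)

/-- `P` minimizes the energy in the class `H^{n/2}_I(D, SO(N))`. -/
def IsMinimizer {n N : ℕ} (D : Set (EuclideanSpace ℝ (Fin n)))
    (Ω P : EuclideanSpace ℝ (Fin n) → Matrix (Fin N) (Fin N) ℝ) : Prop :=
  Admissible D P ∧ ∀ Q : EuclideanSpace ℝ (Fin n) → Matrix (Fin N) (Fin N) ℝ,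
    Admissible D Q → energy Ω P ≤ energy Ω Q

end FracGauge

end

/-! The proof is the direct method. The Frobenius norm is invariant under rotations, so for
admissible Q the outer factor Q can be dropped: E(Q) is the squared norm of Δ^{n/4}(Qᵀ - I) + Ω Qᵀ
(`Admissible.energy_eq`). This removes the product of Q with its own fractional Laplacian. Together
with |Ω Qᵀ| = |Ω| it also gives ‖Δ^{n/4}(Q - I)‖² ≤ 2 E(Q) + 2 ‖Ω‖², which is the coercivity
estimate. Comparison with the competitor Q = I, whose energy is ‖Ω‖², then yields the bound with
constant 2 for every minimizer.

For existence, a minimizing sequence is bounded in H^{n/2}: the L² part is controlled by |Q|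
entrywise and by the bounded support, the other part by coercivity. A Rellich theorem, proved on the
Fourier side, gives a subsequence converging almost everywhere with weakly convergent fractional
Laplacians (`exists_subseq_fracGraph`, `exists_subseq_admissible`). Pointwise convergence preserves
both the support condition and the closed constraint Q ∈ SO(N). It also makes Ω Qᵀ converge weakly,
by domination, so the whole integrand of the energy converges weakly and weak lower semicontinuity
of the norm (`toReal_energy_le_of_tendsto`) finishes the argument. -/

namespace FracGauge

open Filter Topology
open scoped InnerProductSpace

/-! ### Weak sequential convergence in Hilbert spaces. -/

section WeakConvergence

variable {H : Type*} [NormedAddCommGroup H] [InnerProductSpace ℝ H] [CompleteSpace H]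

/-- Bounded sequences in a separable Hilbert space have weakly convergent subsequences. -/
theorem exists_subseq_tendsto_inner [TopologicalSpace.SeparableSpace H] (x : ℕ → H) (C : ℝ)
    (hx : ∀ k, ‖x k‖ ≤ C) :
    ∃ (a : H) (φ : ℕ → ℕ), StrictMono φ ∧
      ∀ h : H, Tendsto (fun k => ⟪h, x (φ k)⟫_ℝ) atTop (𝓝 ⟪h, a⟫_ℝ) := by
  have hmem : ∀ k, StrongDual.toWeakDual (InnerProductSpace.toDual ℝ H (x k)) ∈
      WeakDual.toStrongDual ⁻¹' Metric.closedBall (0 : StrongDual ℝ H) C := by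
    intro k
    simpa using hx k
  -- Sequential Banach–Alaoglu in the dual; the Riesz isomorphism carries the limit back to `H`.
  obtain ⟨L, -, φ, hφ, hL⟩ := WeakDual.isSeqCompact_closedBall ℝ H 0 C hmem
  refine ⟨(InnerProductSpace.toDual ℝ H).symm (WeakDual.toStrongDual L), φ, hφ, fun h => ?_⟩
  have h1 := ((WeakDual.eval_continuous h).tendsto L).comp hL
  rw [real_inner_comm, InnerProductSpace.toDual_symm_apply]
  refine h1.congr fun k => ?_
  simp only [Function.comp_apply]
  rw [real_inner_comm]
  rfl

/-- Continuous linear functionals preserve weak convergence. -/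
theorem tendsto_clm_of_tendsto_inner {x : ℕ → H} {a : H}
    (hx : ∀ h : H, Tendsto (fun k => ⟪h, x k⟫_ℝ) atTop (𝓝 ⟪h, a⟫_ℝ)) (L : H →L[ℝ] ℝ) :
    Tendsto (fun k => L (x k)) atTop (𝓝 (L a)) := by
  have := hx ((InnerProductSpace.toDual ℝ H).symm L)
  simpa only [InnerProductSpace.toDual_symm_apply] using this

theorem tendsto_clm_complex_of_tendsto_inner {x : ℕ → H} {a : H}
    (hx : ∀ h : H, Tendsto (fun k => ⟪h, x k⟫_ℝ) atTop (𝓝 ⟪h, a⟫_ℝ)) (L : H →L[ℝ] ℂ) :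
    Tendsto (fun k => L (x k)) atTop (𝓝 (L a)) := by
  have hre := tendsto_clm_of_tendsto_inner hx (Complex.reCLM.comp L)
  have him := tendsto_clm_of_tendsto_inner hx (Complex.imCLM.comp L)
  have h := (Complex.continuous_ofReal.tendsto _).comp hre |>.add
    (((Complex.continuous_ofReal.tendsto _).comp him).mul_const Complex.I)
  simpa [Function.comp_def, Complex.re_add_im] using h

/-- Closed subspaces are weakly sequentially closed. -/
theorem mem_of_tendsto_inner (K : Submodule ℝ H) (hK : IsClosed (K : Set H)) {x : ℕ → H} {a : H}
    (hx : ∀ h : H, Tendsto (fun k => ⟪h, x k⟫_ℝ) atTop (𝓝 ⟪h, a⟫_ℝ)) (hmem : ∀ k, x k ∈ K) :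
    a ∈ K := by
  have : CompleteSpace K := hK.completeSpace_coe
  -- A closed subspace equals its double orthogonal, so membership is a family of equations ⟪u, ·⟫ =
  -- 0, each stable under weak limits.
  rw [← K.orthogonal_orthogonal, Submodule.mem_orthogonal]
  intro u hu
  refine tendsto_nhds_unique (hx u) ?_
  have : ∀ k, ⟪u, x k⟫_ℝ = 0 := fun k =>
    (Submodule.mem_orthogonal' K u).1 hu _ (hmem k)
  simp [this]

end WeakConvergence

/-- Simultaneous extraction of subsequences for a finite family of properties. -/
theorem exists_subseq_forall_of_finite {ι : Type*} [Finite ι] (p : ι → (ℕ → ℕ) → Prop)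
    (hex : ∀ i (φ : ℕ → ℕ), StrictMono φ → ∃ ψ : ℕ → ℕ, StrictMono ψ ∧ p i (φ ∘ ψ))
    (hsub : ∀ i (φ ψ : ℕ → ℕ), p i φ → StrictMono ψ → p i (φ ∘ ψ)) :
    ∃ φ : ℕ → ℕ, StrictMono φ ∧ ∀ i, p i φ := by
  classical
  have : Fintype ι := Fintype.ofFinite ι
  suffices ∀ s : Finset ι, ∃ φ : ℕ → ℕ, StrictMono φ ∧ ∀ i ∈ s, p i φ by
    obtain ⟨φ, hφ, h⟩ := this Finset.univ
    exact ⟨φ, hφ, fun i => h i (Finset.mem_univ i)⟩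
  intro s
  induction s using Finset.induction_on with
  | empty => exact ⟨id, strictMono_id, by simp⟩
  | insert i s _ ih =>
    obtain ⟨φ, hφ, h⟩ := ih
    obtain ⟨ψ, hψ, hi⟩ := hex i φ hφ
    refine ⟨φ ∘ ψ, hφ.comp hψ, fun j hj => ?_⟩
    rcases Finset.mem_insert.1 hj with rfl | hj
    · exact hi
    · exact hsub j φ ψ (h j hj) hψ

/-! ### Fourier transforms of functions with support of finite measure, and Rellich compactness. -/

section Fourier

variable {E : Type*} [NormedAddCommGroup E] [InnerProductSpace ℝ E]

/-- The truncated plane wave `x ↦ 1_B(x) e^{2πi x·ξ}`. -/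
noncomputable def planeWave (B : Set E) (ξ : E) : E → ℂ :=
  B.indicator fun x => (Real.fourierChar ⟪x, ξ⟫_ℝ : ℂ)

theorem norm_planeWave_le (B : Set E) (ξ x : E) :
    ‖planeWave B ξ x‖ ≤ ‖B.indicator (fun _ => (1 : ℂ)) x‖ := by
  by_cases h : x ∈ B <;> simp [planeWave, h, (Circle.norm_coe _).le]

variable [FiniteDimensional ℝ E] [MeasurableSpace E] [BorelSpace E]

/-- The `L²` Fourier transform of an integrable function is its Fourier integral. -/
theorem fourier_ae_eq_fourierIntegral (f : Lp (α := E) ℂ 2 volume) (hf : Integrable f volume) :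
    (𝓕 f : Lp (α := E) ℂ 2 volume) =ᵐ[volume] 𝓕 (f : E → ℂ) := by
  have hcont : Continuous (𝓕 (f : E → ℂ)) :=
    VectorFourier.fourierIntegral_continuous Real.continuous_fourierChar
      (L := innerₗ E) continuous_inner hf
  refine ae_eq_of_integral_contDiff_smul_eq
    ((Lp.memLp (𝓕 f)).locallyIntegrable (by norm_num)) hcont.locallyIntegrable ?_
  -- A smooth compactly supported test function is Schwartz, so the L² transform can be evaluated as
  -- a tempered distribution; the multiplication formula for integrable functions then moves the
  -- transform back onto `f`.
  intro g g_smooth g_cpt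
  have hg₁ : HasCompactSupport (Complex.ofRealCLM ∘ g) := g_cpt.comp_left rfl
  have hg₂ : ContDiff ℝ (↑(⊤ : ℕ∞)) (Complex.ofRealCLM ∘ g) := by fun_prop
  set G := hg₁.toSchwartzMap hg₂ with hG
  have h1 : (∫ x, g x • (𝓕 f : Lp (α := E) ℂ 2 volume) x)
      = Lp.toTemperedDistribution (𝓕 f) G := by
    simp [hG]
  rw [h1, ← Lp.fourier_toTemperedDistribution_eq, TemperedDistribution.fourier_apply,
    Lp.toTemperedDistribution_apply]
  have h2 := VectorFourier.integral_fourierIntegral_smul_eq_flip (L := innerₗ E) (μ := volume)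
    (ν := volume) Real.continuous_fourierChar continuous_inner G.integrable hf
  simp only [flip_innerₗ] at h2
  refine Eq.trans ?_ (h2.trans ?_)
  · rfl
  · refine integral_congr_ae (Eventually.of_forall fun x => ?_)
    simp only [hG]
    rfl

theorem norm_sq_eq_integral (f : Lp (α := E) ℂ 2 volume) : ‖f‖ ^ 2 = ∫ x, ‖f x‖ ^ 2 := by
  have h := L2.inner_def (𝕜 := ℂ) f f
  rw [inner_self_eq_norm_sq_to_K] at h
  have h2 : (∫ a, ⟪f a, f a⟫_ℂ) = ((∫ a, ‖f a‖ ^ 2 : ℝ) : ℂ) := by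
    rw [← integral_complex_ofReal]
    refine integral_congr_ae (Eventually.of_forall fun x => ?_)
    simp [inner_self_eq_norm_sq_to_K]
  rw [h2] at h
  exact Complex.ofReal_injective ((Complex.ofReal_pow _ _).trans h)

theorem memLp_planeWave {B : Set E} (hB : MeasurableSet B) (hfin : volume B ≠ ∞) (ξ : E) :
    MemLp (planeWave B ξ) 2 volume := by
  refine (memLp_indicator_const 2 hB (1 : ℂ) (Or.inr hfin)).mono ?_
    (Eventually.of_forall (norm_planeWave_le B ξ))
  refine (Continuous.aestronglyMeasurable ?_).indicator hB
  exact continuous_subtype_val.comp (Real.continuous_fourierChar.comp (by fun_prop))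

/-- The bound does not depend on ξ; by Cauchy–Schwarz it bounds the Fourier transforms uniformly on
low frequencies. -/
theorem norm_toLp_planeWave_le {B : Set E} (hB : MeasurableSet B) (hfin : volume B ≠ ∞) (ξ : E) :
    ‖(memLp_planeWave hB hfin ξ).toLp _‖ ≤ ‖indicatorConstLp 2 hB hfin (1 : ℂ)‖ := by
  refine Lp.norm_le_norm_of_ae_le ?_
  filter_upwards [(memLp_planeWave hB hfin ξ).coeFn_toLp,
    indicatorConstLp_coeFn (p := 2) (hs := hB) (hμs := hfin) (c := (1 : ℂ))] with x h1 h2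
  rw [h1, h2]
  exact norm_planeWave_le B ξ x

/-- The Fourier transform of a function supported in a set of finite measure, pointwise. -/
theorem fourier_ae_eq_inner {B : Set E} (hB : MeasurableSet B) (hfin : volume B ≠ ∞)
    (f : Lp (α := E) ℂ 2 volume) (hsupp : ∀ᵐ x, x ∉ B → f x = 0) :
    ∀ᵐ ξ, (𝓕 f : Lp (α := E) ℂ 2 volume) ξ = ⟪(memLp_planeWave hB hfin ξ).toLp _, f⟫_ℂ := by
  have hint : Integrable f volume := by
    have h1 : IntegrableOn f B volume :=
      have : IsFiniteMeasure (volume.restrict B) := ⟨by simpa using hfin.lt_top⟩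
      ((Lp.memLp f).restrict B).integrable (by norm_num)
    rw [← integrable_indicator_iff hB] at h1
    refine h1.congr ?_
    filter_upwards [hsupp] with x hx
    by_cases h : x ∈ B <;> simp [h, hx]
  filter_upwards [fourier_ae_eq_fourierIntegral f hint] with ξ hξ
  rw [hξ, L2.inner_def, Real.fourier_eq]
  refine integral_congr_ae ?_
  filter_upwards [hsupp, (memLp_planeWave hB hfin ξ).coeFn_toLp] with x hx h1
  rw [h1]
  by_cases h : x ∈ B
  · simp [planeWave, h, Circle.smul_def, AddChar.map_neg_eq_inv, mul_comm]
  · simp [h, hx]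

/-- Rellich's theorem for fractional Sobolev spaces, for weak null sequences. -/
theorem tendsto_zero_of_weak_of_fourier_bound {B : Set E} (hB : MeasurableSet B)
    (hfin : volume B ≠ ∞) {s : ℝ} (hs : 0 < s) (d g : ℕ → Lp (α := E) ℂ 2 volume) {C C' : ℝ}
    (hweak : ∀ h : Lp (α := E) ℂ 2 volume, Tendsto (fun k => ⟪h, d k⟫_ℂ) atTop (𝓝 0))
    (hd : ∀ k, ‖d k‖ ≤ C) (hg : ∀ k, ‖g k‖ ≤ C')
    (hsupp : ∀ k, ∀ᵐ x, x ∉ B → d k x = 0)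
    (hdg : ∀ k, ∀ᵐ ξ, (𝓕 (g k)) ξ = (((2 * Real.pi * ‖ξ‖) ^ s : ℝ) : ℂ) * (𝓕 (d k)) ξ) :
    Tendsto (fun k => ‖d k‖) atTop (𝓝 0) := by
  set c : ℝ := ‖indicatorConstLp 2 hB hfin (1 : ℂ)‖
  have hC : 0 ≤ C := (norm_nonneg _).trans (hd 0)
  have hint : ∀ u : Lp (α := E) ℂ 2 volume, Integrable (fun ξ => ‖u ξ‖ ^ 2) := fun u =>
    (memLp_two_iff_integrable_sq_norm (Lp.aestronglyMeasurable u)).1 (Lp.memLp u)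
  -- Low frequencies: at almost every ξ the transform is a pairing with a fixed plane wave, so weak
  -- convergence gives pointwise convergence, and the constant (c C)² dominates on a ball of finite
  -- measure.
  have hlow : ∀ M : ℝ, Tendsto (fun k => ∫ ξ in Metric.closedBall (0 : E) M, ‖(𝓕 (d k)) ξ‖ ^ 2)
      atTop (𝓝 0) := by
    intro M
    have h0 : (0 : ℝ) = ∫ ξ in Metric.closedBall (0 : E) M, (0 : ℝ) := by simp
    rw [h0]
    refine tendsto_integral_of_dominated_convergence (fun _ => (c * C) ^ 2)
      (fun k => ((Lp.aestronglyMeasurable _).norm.pow 2).restrict) ?_ ?_ ?_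
    · exact integrableOn_const (by
        exact (isCompact_closedBall (0 : E) M).measure_lt_top.ne)
    · intro k
      refine ae_restrict_of_ae ?_
      filter_upwards [fourier_ae_eq_inner hB hfin (d k) (hsupp k)] with ξ hξ
      rw [Real.norm_of_nonneg (by positivity), hξ]
      gcongr
      refine (norm_inner_le_norm _ _).trans ?_
      gcongr
      · exact norm_toLp_planeWave_le hB hfin ξ
      · exact hd k
    · refine ae_restrict_of_ae ?_
      filter_upwards [ae_all_iff.2 fun k => fourier_ae_eq_inner hB hfin (d k) (hsupp k)] with ξ hξ
      simp only [hξ]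
      simpa using ((hweak ((memLp_planeWave hB hfin ξ).toLp _)).norm.pow 2)
  -- High frequencies: outside the ball the symbol is at least (2πM)^s, so the transform of `d k` is
  -- at most (2πM)^{-s} times that of `g k`.
  have hsplit : ∀ M : ℝ, 0 < M → ∀ k, ‖d k‖ ^ 2 ≤
      (∫ ξ in Metric.closedBall (0 : E) M, ‖(𝓕 (d k)) ξ‖ ^ 2)
        + ((2 * Real.pi * M) ^ s)⁻¹ ^ 2 * C' ^ 2 := by
    intro M hM k
    have hMs : 0 < (2 * Real.pi * M) ^ s := by positivity
    calc ‖d k‖ ^ 2 = ∫ ξ, ‖(𝓕 (d k)) ξ‖ ^ 2 := by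
          rw [← norm_sq_eq_integral, Lp.norm_fourier_eq]
      _ ≤ ∫ ξ, ((Metric.closedBall (0 : E) M).indicator (fun ξ => ‖(𝓕 (d k)) ξ‖ ^ 2) ξ
            + ((2 * Real.pi * M) ^ s)⁻¹ ^ 2 * ‖(𝓕 (g k)) ξ‖ ^ 2) := by
          refine integral_mono_ae (hint _) (((hint _).indicator
            Metric.isClosed_closedBall.measurableSet).add ((hint _).const_mul _)) ?_
          filter_upwards [hdg k] with ξ hξ
          by_cases h : ξ ∈ Metric.closedBall (0 : E) M
          · simp only [Set.indicator_of_mem h]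
            have : 0 ≤ ((2 * Real.pi * M) ^ s)⁻¹ ^ 2 * ‖(𝓕 (g k)) ξ‖ ^ 2 := by positivity
            linarith
          · simp only [Set.indicator_of_notMem h, zero_add]
            have hMξ : M ≤ ‖ξ‖ := by
              simp only [Metric.mem_closedBall, dist_zero_right, not_le] at h
              exact h.le
            rw [← mul_pow, hξ, norm_mul, Complex.norm_real,
              Real.norm_of_nonneg (by positivity : 0 ≤ (2 * Real.pi * ‖ξ‖) ^ s), ← mul_assoc]
            refine pow_le_pow_left₀ (norm_nonneg _) (le_mul_of_one_le_left (norm_nonneg _) ?_) 2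
            rw [inv_mul_eq_div, one_le_div hMs]
            gcongr
      _ = (∫ ξ in Metric.closedBall (0 : E) M, ‖(𝓕 (d k)) ξ‖ ^ 2)
            + ((2 * Real.pi * M) ^ s)⁻¹ ^ 2 * ‖g k‖ ^ 2 := by
          rw [integral_add ((hint _).indicator Metric.isClosed_closedBall.measurableSet)
            ((hint _).const_mul _), integral_indicator Metric.isClosed_closedBall.measurableSet,
            integral_const_mul, ← norm_sq_eq_integral (𝓕 (g k)), Lp.norm_fourier_eq]
      _ ≤ _ := by
          gcongr
          exact hg k
  have htail : Tendsto (fun M : ℝ => ((2 * Real.pi * M) ^ s)⁻¹ ^ 2 * C' ^ 2) atTop (𝓝 0) := by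
    have h1 : Tendsto (fun M : ℝ => (2 * Real.pi * M) ^ s) atTop atTop :=
      (tendsto_rpow_atTop hs).comp (tendsto_id.const_mul_atTop (by positivity))
    simpa using ((tendsto_inv_atTop_zero.comp h1).pow 2).mul_const (C' ^ 2)
  have hsq : Tendsto (fun k => ‖d k‖ ^ 2) atTop (𝓝 0) := by
    rw [Metric.tendsto_atTop]
    intro ε hε
    -- The cutoff `M` is fixed first, uniformly in `k`; only then is `k` taken large.
    obtain ⟨M, hM1, hM0⟩ := ((htail.eventually (gt_mem_nhds (half_pos hε))).and
      (eventually_gt_atTop 0)).exists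
    obtain ⟨K, hK⟩ := eventually_atTop.1 ((hlow M).eventually (gt_mem_nhds (half_pos hε)))
    refine ⟨K, fun k hk => ?_⟩
    rw [dist_zero_right, Real.norm_of_nonneg (by positivity)]
    linarith [hsplit M hM0 k, hK k hk]
  simpa using hsq.sqrt

end Fourier

/-! ### The closed graph of Δ^{s/2} and compactness of bounded sequences in it. -/

section Graph

variable {n : ℕ}

/-- The inclusion of real valued into complex valued square integrable functions. -/
noncomputable def complexify (n : ℕ) : Lp (α := EuclideanSpace ℝ (Fin n)) ℝ 2 volume →L[ℝ]
    Lp (α := EuclideanSpace ℝ (Fin n)) ℂ 2 volume :=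
  Complex.ofRealCLM.compLpL 2 volume

theorem toL2_eq_complexify (f : EuclideanSpace ℝ (Fin n) → ℝ) (hf : MemLp f 2 volume) :
    toL2 f hf = complexify n (hf.toLp f) := by
  apply Lp.ext
  filter_upwards [(hf.ofReal (K := ℂ)).coeFn_toLp,
    Complex.ofRealCLM.coeFn_compLpL (p := 2) (μ := volume) (hf.toLp f), hf.coeFn_toLp]
    with x h1 h2 h3
  rw [complexify, h2, h3]
  exact h1

theorem norm_complexify (f : Lp (α := EuclideanSpace ℝ (Fin n)) ℝ 2 volume) :
    ‖complexify n f‖ = ‖f‖ := by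
  have h : ∀ᵐ x, ‖complexify n f x‖ = ‖f x‖ := by
    filter_upwards [Complex.ofRealCLM.coeFn_compLpL (p := 2) (μ := volume) f] with x hx
    rw [complexify, hx]
    simp
  exact le_antisymm (Lp.norm_le_norm_of_ae_le (h.mono fun _ hx => hx.le))
    (Lp.norm_le_norm_of_ae_le (h.mono fun _ hx => hx.ge))

/-- The relation `ĝ = (2π|ξ|)^s f̂` between complex square integrable functions. -/
def IsFourierMultiple (s : ℝ) (f g : Lp (α := EuclideanSpace ℝ (Fin n)) ℂ 2 volume) : Prop :=
  ∀ᵐ ξ : EuclideanSpace ℝ (Fin n),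
    (𝓕 g) ξ = (((2 * Real.pi * ‖ξ‖) ^ s : ℝ) : ℂ) * (𝓕 f) ξ

theorem IsFourierMultiple.add {s : ℝ} {f g f' g' : Lp (α := EuclideanSpace ℝ (Fin n)) ℂ 2 volume}
    (h : IsFourierMultiple s f g) (h' : IsFourierMultiple s f' g') :
    IsFourierMultiple s (f + f') (g + g') := by
  unfold IsFourierMultiple
  rw [FourierTransform.fourier_add, FourierTransform.fourier_add]
  filter_upwards [h, h', Lp.coeFn_add (𝓕 f) (𝓕 f'), Lp.coeFn_add (𝓕 g) (𝓕 g')]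
    with ξ h1 h2 h3 h4
  rw [h3, h4, Pi.add_apply, Pi.add_apply, h1, h2, mul_add]

theorem IsFourierMultiple.smul {s : ℝ} {f g : Lp (α := EuclideanSpace ℝ (Fin n)) ℂ 2 volume}
    (h : IsFourierMultiple s f g) (c : ℂ) : IsFourierMultiple s (c • f) (c • g) := by
  unfold IsFourierMultiple
  rw [FourierTransform.fourier_smul, FourierTransform.fourier_smul]
  filter_upwards [h, Lp.coeFn_smul c (𝓕 f), Lp.coeFn_smul c (𝓕 g)] with ξ h1 h3 h4
  rw [h3, h4, Pi.smul_apply, Pi.smul_apply, h1, smul_eq_mul, smul_eq_mul, mul_left_comm]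

theorem IsFourierMultiple.sub {s : ℝ} {f g f' g' : Lp (α := EuclideanSpace ℝ (Fin n)) ℂ 2 volume}
    (h : IsFourierMultiple s f g) (h' : IsFourierMultiple s f' g') :
    IsFourierMultiple s (f - f') (g - g') := by
  have := h.add (h'.smul (-1))
  rwa [neg_one_smul, neg_one_smul, ← sub_eq_add_neg, ← sub_eq_add_neg] at this

theorem IsFourierMultiple.zero (s : ℝ) :
    IsFourierMultiple s (0 : Lp (α := EuclideanSpace ℝ (Fin n)) ℂ 2 volume) 0 := by
  unfold IsFourierMultiple
  have h0 : 𝓕 (0 : Lp (α := EuclideanSpace ℝ (Fin n)) ℂ 2 volume) = 0 :=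
    (Lp.fourierTransformₗᵢ (EuclideanSpace ℝ (Fin n)) ℂ).map_zero
  rw [h0]
  filter_upwards [Lp.coeFn_zero (E := ℂ) (p := 2)
    (μ := (volume : Measure (EuclideanSpace ℝ (Fin n))))] with ξ h
  rw [h]
  simp

theorem exists_subseq_ae_tendsto {E F : Type*} [MeasurableSpace E] {μ : Measure E}
    [NormedAddCommGroup F] {u : ℕ → Lp F 2 μ} {v : Lp F 2 μ} (h : Tendsto u atTop (𝓝 v)) :
    ∃ φ : ℕ → ℕ, StrictMono φ ∧ ∀ᵐ x ∂μ, Tendsto (fun k => u (φ k) x) atTop (𝓝 (v x)) :=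
  (tendstoInMeasure_of_tendsto_Lp h).exists_seq_tendsto_ae

/-- By Plancherel both transforms converge in L², hence almost everywhere along a common
subsequence, and the pointwise relation passes to the limit even though the symbol is unbounded. -/
theorem IsFourierMultiple.of_tendsto {s : ℝ}
    {f g : ℕ → Lp (α := EuclideanSpace ℝ (Fin n)) ℂ 2 volume}
    {f' g' : Lp (α := EuclideanSpace ℝ (Fin n)) ℂ 2 volume}
    (h : ∀ k, IsFourierMultiple s (f k) (g k)) (hf : Tendsto f atTop (𝓝 f'))
    (hg : Tendsto g atTop (𝓝 g')) : IsFourierMultiple s f' g' := by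
  have hcont := (Lp.fourierTransformₗᵢ (EuclideanSpace ℝ (Fin n)) ℂ).continuous
  obtain ⟨φ, hφ, h1⟩ := exists_subseq_ae_tendsto ((hcont.tendsto f').comp hf)
  obtain ⟨ψ, hψ, h2⟩ := exists_subseq_ae_tendsto
    (((hcont.tendsto g').comp hg).comp hφ.tendsto_atTop)
  unfold IsFourierMultiple
  filter_upwards [h1, h2, ae_all_iff.2 h] with ξ h1 h2 h3
  refine tendsto_nhds_unique h2 ?_
  refine ((h1.comp hψ.tendsto_atTop).const_mul
    (((2 * Real.pi * ‖ξ‖) ^ s : ℝ) : ℂ)).congr fun k => ?_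
  exact (h3 _).symm

/-- The graph of `Δ^{s/2}` in `L² × L²`. -/
noncomputable def fracGraph (n : ℕ) (s : ℝ) : Submodule ℝ
    (WithLp 2 (Lp (α := EuclideanSpace ℝ (Fin n)) ℝ 2 volume ×
      Lp (α := EuclideanSpace ℝ (Fin n)) ℝ 2 volume)) where
  carrier := {p | IsFourierMultiple s (complexify n p.fst) (complexify n p.snd)}
  add_mem' {p q} hp hq := by
    simp only [Set.mem_ofPred_eq, WithLp.add_fst, WithLp.add_snd, map_add] at *
    exact hp.add hq
  zero_mem' := by
    simp only [Set.mem_ofPred_eq, WithLp.zero_fst, WithLp.zero_snd, map_zero]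
    exact IsFourierMultiple.zero s
  smul_mem' c p hp := by
    simp only [Set.mem_ofPred_eq, WithLp.smul_fst, WithLp.smul_snd, map_smul] at *
    exact hp.smul (c : ℂ)

theorem isClosed_fracGraph (s : ℝ) : IsClosed (fracGraph n s : Set
    (WithLp 2 (Lp (α := EuclideanSpace ℝ (Fin n)) ℝ 2 volume ×
      Lp (α := EuclideanSpace ℝ (Fin n)) ℝ 2 volume))) := by
  refine IsSeqClosed.isClosed fun u p hu hp => ?_
  refine IsFourierMultiple.of_tendsto hu ?_ ?_
  · exact (((complexify n).continuous.comp
      (continuous_fst.comp (WithLp.prod_continuous_ofLp 2 _ _))).tendsto p).comp hp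
  · exact (((complexify n).continuous.comp
      (continuous_snd.comp (WithLp.prod_continuous_ofLp 2 _ _))).tendsto p).comp hp

theorem hasFracLaplacian_iff {s : ℝ} {f g : EuclideanSpace ℝ (Fin n) → ℝ}
    (hf : MemLp f 2 volume) (hg : MemLp g 2 volume) :
    HasFracLaplacian s f g ↔ WithLp.toLp 2 (hf.toLp f, hg.toLp g) ∈ fracGraph n s := by
  change _ ↔ IsFourierMultiple s (complexify n (hf.toLp f)) (complexify n (hg.toLp g))
  rw [← toL2_eq_complexify, ← toL2_eq_complexify]
  exact ⟨fun ⟨_, _, h⟩ => h, fun h => ⟨hf, hg, h⟩⟩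

theorem hasFracLaplacian_of_mem_fracGraph {s : ℝ}
    {f g : Lp (α := EuclideanSpace ℝ (Fin n)) ℝ 2 volume}
    (h : WithLp.toLp 2 (f, g) ∈ fracGraph n s) : HasFracLaplacian s f g := by
  rw [hasFracLaplacian_iff (Lp.memLp f) (Lp.memLp g), Lp.toLp_coeFn, Lp.toLp_coeFn]
  exact h

theorem hasFracLaplacian_zero (s : ℝ) :
    HasFracLaplacian s (fun _ : EuclideanSpace ℝ (Fin n) => (0 : ℝ)) (fun _ => 0) := by
  rw [hasFracLaplacian_iff MemLp.zero' MemLp.zero']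
  exact (fracGraph n s).zero_mem

/-- Vanishing off `B` means lying in the kernel of the restriction to the complement, a closed
subspace and therefore weakly closed. -/
theorem ae_eq_zero_of_tendsto_inner {B : Set (EuclideanSpace ℝ (Fin n))} (hB : MeasurableSet B)
    {f : ℕ → Lp (α := EuclideanSpace ℝ (Fin n)) ℝ 2 volume}
    {f' : Lp (α := EuclideanSpace ℝ (Fin n)) ℝ 2 volume}
    (hweak : ∀ h, Tendsto (fun k => ⟪h, f k⟫_ℝ) atTop (𝓝 ⟪h, f'⟫_ℝ))
    (hsupp : ∀ k, ∀ᵐ x, x ∉ B → f k x = 0) : ∀ᵐ x, x ∉ B → f' x = 0 := by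
  let R : Lp (α := EuclideanSpace ℝ (Fin n)) ℝ 2 volume →L[ℝ] Lp ℝ 2 (volume.restrict Bᶜ) :=
    LpToLpRestrictCLM (EuclideanSpace ℝ (Fin n)) ℝ ℝ volume 2 Bᶜ
  have hR : ∀ u : Lp (α := EuclideanSpace ℝ (Fin n)) ℝ 2 volume,
      u ∈ R.ker ↔ ∀ᵐ x, x ∉ B → u x = 0 := by
    intro u
    rw [LinearMap.mem_ker, ContinuousLinearMap.coe_coe, Lp.eq_zero_iff_ae_eq_zero]
    have h1 : R u =ᵐ[volume.restrict Bᶜ] u := LpToLpRestrictCLM_coeFn ℝ Bᶜ u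
    have h2 : R u =ᵐ[volume.restrict Bᶜ] 0 ↔ u =ᵐ[volume.restrict Bᶜ] 0 :=
      ⟨fun h => h1.symm.trans h, fun h => h1.trans h⟩
    rw [h2, EventuallyEq, ae_restrict_iff' hB.compl]
    rfl
  exact (hR f').1 (mem_of_tendsto_inner _ R.isClosed_ker hweak fun k => (hR _).2 (hsupp _))

theorem tendsto_inner_complexify_sub
    {f : ℕ → Lp (α := EuclideanSpace ℝ (Fin n)) ℝ 2 volume}
    {f' : Lp (α := EuclideanSpace ℝ (Fin n)) ℝ 2 volume}
    (hweak : ∀ h, Tendsto (fun k => ⟪h, f k⟫_ℝ) atTop (𝓝 ⟪h, f'⟫_ℝ))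
    (h : Lp (α := EuclideanSpace ℝ (Fin n)) ℂ 2 volume) :
    Tendsto (fun k => ⟪h, complexify n (f k - f')⟫_ℂ) atTop (𝓝 0) := by
  have h1 : Tendsto (fun k => ⟪h, complexify n (f k)⟫_ℂ) atTop (𝓝 ⟪h, complexify n f'⟫_ℂ) :=
    tendsto_clm_complex_of_tendsto_inner hweak
      (((innerSL ℂ h).restrictScalars ℝ).comp (complexify n))
  rw [← sub_self ⟪h, complexify n f'⟫_ℂ]
  refine (h1.sub_const _).congr fun k => ?_
  rw [map_sub, inner_sub_right]

/-- Rellich's theorem: weak convergence of a sequence bounded in `H^s`, with supports in a fixed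
set of finite measure, is strong in `L²`. -/
theorem tendsto_of_tendsto_inner {s : ℝ} (hs : 0 < s) {B : Set (EuclideanSpace ℝ (Fin n))}
    (hB : MeasurableSet B) (hfin : volume B ≠ ∞)
    {f g : ℕ → Lp (α := EuclideanSpace ℝ (Fin n)) ℝ 2 volume}
    {f' g' : Lp (α := EuclideanSpace ℝ (Fin n)) ℝ 2 volume} {C C' : ℝ}
    (hf : ∀ k, ‖f k‖ ≤ C) (hg : ∀ k, ‖g k‖ ≤ C')
    (hsupp : ∀ k, ∀ᵐ x, x ∉ B → f k x = 0)
    (hfg : ∀ k, IsFourierMultiple s (complexify n (f k)) (complexify n (g k)))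
    (hfg' : IsFourierMultiple s (complexify n f') (complexify n g'))
    (hweak : ∀ h, Tendsto (fun k => ⟪h, f k⟫_ℝ) atTop (𝓝 ⟪h, f'⟫_ℝ)) :
    Tendsto f atTop (𝓝 f') := by
  have hsupp' := ae_eq_zero_of_tendsto_inner hB hweak hsupp
  rw [tendsto_iff_norm_sub_tendsto_zero]
  have hmul : ∀ k, IsFourierMultiple s (complexify n (f k - f')) (complexify n (g k - g')) :=
    fun k => by
      rw [map_sub, map_sub]
      exact (hfg k).sub hfg'
  have hd : ∀ k, ‖complexify n (f k - f')‖ ≤ C + ‖f'‖ := fun k => by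
    rw [norm_complexify]
    exact (norm_sub_le _ _).trans (by gcongr; exact hf _)
  have hd' : ∀ k, ‖complexify n (g k - g')‖ ≤ C' + ‖g'‖ := fun k => by
    rw [norm_complexify]
    exact (norm_sub_le _ _).trans (by gcongr; exact hg _)
  have hzero : ∀ h, Tendsto (fun k => ⟪h, complexify n (f k - f')⟫_ℂ) atTop (𝓝 0) :=
    tendsto_inner_complexify_sub hweak
  have hsuppd : ∀ k, ∀ᵐ x, x ∉ B → complexify n (f k - f') x = 0 := by
    intro k
    filter_upwards [hsupp k, hsupp', Lp.coeFn_sub (f k) f',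
      Complex.ofRealCLM.coeFn_compLpL (p := 2) (μ := volume) (f k - f')] with x h1 h2 h3 h4 hx
    rw [complexify, h4, h3, Pi.sub_apply, h1 hx, h2 hx]
    simp
  have key := tendsto_zero_of_weak_of_fourier_bound hB hfin hs
    (fun k => complexify n (f k - f')) (fun k => complexify n (g k - g')) hzero hd hd' hsuppd hmul
  simpa only [norm_complexify] using key

/-- Bounded sequences in `H^s` with supports in a fixed set of finite measure have subsequences
that converge almost everywhere and whose fractional Laplacians converge weakly. -/
theorem exists_subseq_fracGraph {s : ℝ} (hs : 0 < s) {B : Set (EuclideanSpace ℝ (Fin n))}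
    (hB : MeasurableSet B) (hfin : volume B ≠ ∞)
    (f g : ℕ → Lp (α := EuclideanSpace ℝ (Fin n)) ℝ 2 volume) {C C' : ℝ}
    (hf : ∀ k, ‖f k‖ ≤ C) (hg : ∀ k, ‖g k‖ ≤ C')
    (hsupp : ∀ k, ∀ᵐ x, x ∉ B → f k x = 0)
    (hfg : ∀ k, IsFourierMultiple s (complexify n (f k)) (complexify n (g k))) :
    ∃ (f' g' : Lp (α := EuclideanSpace ℝ (Fin n)) ℝ 2 volume) (φ : ℕ → ℕ), StrictMono φ ∧
      IsFourierMultiple s (complexify n f') (complexify n g') ∧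
      (∀ᵐ x, Tendsto (fun k => f (φ k) x) atTop (𝓝 (f' x))) ∧
      ∀ h, Tendsto (fun k => ⟪h, g (φ k)⟫_ℝ) atTop (𝓝 ⟪h, g'⟫_ℝ) := by
  -- Finiteness of the exponent makes L² separable, as weak sequential compactness requires.
  have : Fact ((2 : ℝ≥0∞) ≠ ∞) := ⟨by norm_num⟩
  obtain ⟨f', φ, hφ, hf'⟩ := exists_subseq_tendsto_inner f C hf
  obtain ⟨g', ψ, hψ, hg'⟩ := exists_subseq_tendsto_inner (g ∘ φ) C' fun k => hg _
  replace hf' : ∀ h, Tendsto (fun k => ⟪h, f (φ (ψ k))⟫_ℝ) atTop (𝓝 ⟪h, f'⟫_ℝ) := fun h =>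
    (hf' h).comp hψ.tendsto_atTop
  have hmem : IsFourierMultiple s (complexify n f') (complexify n g') := by
    change WithLp.toLp 2 (f', g') ∈ fracGraph n s
    -- In the Hilbert product weak convergence is componentwise, and the graph is weakly closed;
    -- this identifies the weak limit `g'` as the fractional Laplacian of `f'`.
    refine mem_of_tendsto_inner _ (isClosed_fracGraph s)
      (x := fun k => WithLp.toLp 2 (f (φ (ψ k)), g (φ (ψ k)))) (fun h => ?_) fun k => hfg _
    simp only [WithLp.prod_inner_apply]
    exact (hf' h.fst).add (hg' h.snd)
  have hstrong : Tendsto (fun k => f (φ (ψ k))) atTop (𝓝 f') :=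
    tendsto_of_tendsto_inner hs hB hfin (fun k => hf _) (fun k => hg _) (fun k => hsupp _)
      (fun k => hfg _) hmem hf'
  obtain ⟨χ, hχ, hae⟩ := exists_subseq_ae_tendsto hstrong
  exact ⟨f', g', φ ∘ ψ ∘ χ, hφ.comp (hψ.comp hχ), hmem, hae,
    fun h => (hg' h).comp hχ.tendsto_atTop⟩

end Graph

/-! ### Rotation invariance of the Frobenius norm and closedness of SO(N). -/

section Frobenius

variable {N : ℕ}

theorem sum_sq_eq_trace (A : Matrix (Fin N) (Fin N) ℝ) :
    ∑ i, ∑ j, A i j ^ 2 = (A.transpose * A).trace := by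
  simp only [Matrix.trace, Matrix.diag_apply, Matrix.mul_apply, Matrix.transpose_apply, ← sq]
  exact Finset.sum_comm

theorem sum_sq_transpose (A : Matrix (Fin N) (Fin N) ℝ) :
    ∑ i, ∑ j, A.transpose i j ^ 2 = ∑ i, ∑ j, A i j ^ 2 := by
  simp only [Matrix.transpose_apply]
  exact Finset.sum_comm

theorem sum_sq_mul_left {Q : Matrix (Fin N) (Fin N) ℝ}
    (hQ : Q ∈ Matrix.specialOrthogonalGroup (Fin N) ℝ) (A : Matrix (Fin N) (Fin N) ℝ) :
    ∑ i, ∑ j, (Q * A) i j ^ 2 = ∑ i, ∑ j, A i j ^ 2 := by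
  have h : Q.transpose * Q = 1 := (Matrix.mem_orthogonalGroup_iff' (Fin N) ℝ).1
    (Matrix.mem_specialOrthogonalGroup_iff.1 hQ).1
  rw [sum_sq_eq_trace, sum_sq_eq_trace, Matrix.transpose_mul, Matrix.mul_assoc,
    ← Matrix.mul_assoc Q.transpose, h, Matrix.one_mul]

theorem sum_sq_mul_transpose_right {Q : Matrix (Fin N) (Fin N) ℝ}
    (hQ : Q ∈ Matrix.specialOrthogonalGroup (Fin N) ℝ) (A : Matrix (Fin N) (Fin N) ℝ) :
    ∑ i, ∑ j, (A * Q.transpose) i j ^ 2 = ∑ i, ∑ j, A i j ^ 2 := by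
  rw [← sum_sq_transpose, Matrix.transpose_mul, Matrix.transpose_transpose, sum_sq_mul_left hQ,
    sum_sq_transpose]

theorem abs_entry_le_one {Q : Matrix (Fin N) (Fin N) ℝ}
    (hQ : Q ∈ Matrix.specialOrthogonalGroup (Fin N) ℝ) (i j : Fin N) : |Q i j| ≤ 1 :=
  entry_norm_bound_of_unitary (𝕜 := ℝ) (Matrix.mem_specialOrthogonalGroup_iff.1 hQ).1 i j

theorem isClosed_specialOrthogonalGroup :
    IsClosed (Matrix.specialOrthogonalGroup (Fin N) ℝ : Set (Matrix (Fin N) (Fin N) ℝ)) := by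
  have : (Matrix.specialOrthogonalGroup (Fin N) ℝ : Set (Matrix (Fin N) (Fin N) ℝ)) =
      {Q | Q * Q.transpose = 1} ∩ {Q | Q.det = 1} := by
    ext Q
    rw [SetLike.mem_coe, Matrix.mem_specialOrthogonalGroup_iff, Matrix.mem_orthogonalGroup_iff]
    rfl
  rw [this]
  exact (isClosed_eq (by fun_prop) (by fun_prop)).inter (isClosed_eq (by fun_prop) (by fun_prop))

end Frobenius

/-! ### Norms and weak limits of real square integrable functions. -/

theorem norm_sq_toLp_eq_lintegral {α : Type*} [MeasurableSpace α] {μ : Measure α} {f : α → ℝ}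
    (hf : MemLp f 2 μ) : ENNReal.ofReal (‖hf.toLp f‖ ^ 2) = ∫⁻ x, ENNReal.ofReal (f x ^ 2) ∂μ := by
  rw [← real_inner_self_eq_norm_sq, L2.inner_def,
    ← ofReal_integral_eq_lintegral_ofReal hf.integrable_sq
      (Eventually.of_forall fun x => sq_nonneg _)]
  congr 1
  refine integral_congr_ae ?_
  filter_upwards [hf.coeFn_toLp] with x hx
  simp [hx, sq]

theorem tendsto_inner_toLp_of_dominated {α : Type*} [MeasurableSpace α] {μ : Measure α}
    {w : ℕ → α → ℝ} {w' b : α → ℝ} (hw : ∀ k, MemLp (w k) 2 μ) (hw' : MemLp w' 2 μ)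
    (hb : MemLp b 2 μ) (hle : ∀ k, ∀ᵐ x ∂μ, |w k x| ≤ b x)
    (hlim : ∀ᵐ x ∂μ, Tendsto (fun k => w k x) atTop (𝓝 (w' x))) (h : Lp ℝ 2 μ) :
    Tendsto (fun k => ⟪h, (hw k).toLp (w k)⟫_ℝ) atTop (𝓝 ⟪h, hw'.toLp w'⟫_ℝ) := by
  have hrw : ∀ {u : α → ℝ} (hu : MemLp u 2 μ), ⟪h, hu.toLp u⟫_ℝ = ∫ x, h x * u x ∂μ := by
    intro u hu
    rw [L2.inner_def]
    refine integral_congr_ae ?_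
    filter_upwards [hu.coeFn_toLp] with x hx
    simp [hx, mul_comm]
  simp only [hrw]
  refine tendsto_integral_of_dominated_convergence (fun x => ‖h x‖ * b x)
    (fun k => (Lp.aestronglyMeasurable h).mul (hw k).aestronglyMeasurable)
    ((Lp.memLp h).norm.integrable_mul hb) (fun k => ?_) ?_
  · filter_upwards [hle k] with x hx
    rw [norm_mul]
    exact mul_le_mul_of_nonneg_left hx (norm_nonneg _)
  · filter_upwards [hlim] with x hx
    exact hx.const_mul _

/-! ### The energy without its outer rotation, coercivity, and the bound for minimizers. -/

section Energy

variable {n N : ℕ} {D : Set (EuclideanSpace ℝ (Fin n))}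
  {Ω Q : EuclideanSpace ℝ (Fin n) → Matrix (Fin N) (Fin N) ℝ}

theorem matFracLaplacian_transpose_sub_one (s : ℝ)
    (Q : EuclideanSpace ℝ (Fin n) → Matrix (Fin N) (Fin N) ℝ) (x : EuclideanSpace ℝ (Fin n)) :
    matFracLaplacian s (fun y => (Q y).transpose - 1) x =
      (matFracLaplacian s (fun y => Q y - 1) x).transpose := by
  ext i j
  simp only [matFracLaplacian, Matrix.of_apply, Matrix.transpose_apply]
  congr 1
  funext y
  simp [Matrix.one_apply, eq_comm]

/-- `Δ^{n/4}(Qᵀ - I) + Ω Qᵀ`, the gauged potential up to a rotation. -/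
noncomputable def rotatedGauged (Ω Q : EuclideanSpace ℝ (Fin n) → Matrix (Fin N) (Fin N) ℝ)
    (x : EuclideanSpace ℝ (Fin n)) : Matrix (Fin N) (Fin N) ℝ :=
  (matFracLaplacian ((n : ℝ) / 2) (fun y => Q y - 1) x).transpose + Ω x * (Q x).transpose

theorem gauged_eq_mul_rotatedGauged (Ω Q : EuclideanSpace ℝ (Fin n) → Matrix (Fin N) (Fin N) ℝ)
    (x : EuclideanSpace ℝ (Fin n)) : gauged Ω Q x = Q x * rotatedGauged Ω Q x := by
  rw [gauged, rotatedGauged, matFracLaplacian_transpose_sub_one, Matrix.mul_add, Matrix.mul_assoc]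

/-- Left multiplication by a rotation preserves the Frobenius norm. What remains is affine in `Q`,
so it is compatible with weak limits. -/
theorem Admissible.energy_eq (hQ : Admissible D Q) :
    energy Ω Q = matL2NormSq (rotatedGauged Ω Q) := by
  refine lintegral_congr_ae ?_
  filter_upwards [hQ.mem_SO] with x hx
  rw [gauged_eq_mul_rotatedGauged, sum_sq_mul_left hx]

theorem Admissible.memLp_matFracLaplacian (hQ : Admissible D Q) (i j : Fin N) :
    MemLp (fun x => matFracLaplacian ((n : ℝ) / 2) (fun y => Q y - 1) x i j) 2 volume :=
  (hQ.memH i j).hasFracLaplacian.2.1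

theorem Admissible.memLp_mul_transpose (hQ : Admissible D Q)
    (hΩ : ∀ i j, MemLp (fun x => Ω x i j) 2 volume) (i j : Fin N) :
    MemLp (fun x => (Ω x * (Q x).transpose) i j) 2 volume := by
  simp only [Matrix.mul_apply, Matrix.transpose_apply]
  refine memLp_finsetSum _ fun l _ => ?_
  have hm : AEStronglyMeasurable (fun x => Q x j l) volume := by
    obtain ⟨_, h, _⟩ := hQ.memH j l
    refine (h.aestronglyMeasurable.add
      (aestronglyMeasurable_const (b := (1 : Matrix (Fin N) (Fin N) ℝ) j l))).congr ?_
    exact Eventually.of_forall fun x => by simp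
  refine (hΩ i l).mono ((hΩ i l).aestronglyMeasurable.mul hm) ?_
  filter_upwards [hQ.mem_SO] with x hx
  rw [norm_mul]
  exact mul_le_of_le_one_right (norm_nonneg _) (abs_entry_le_one hx j l)

theorem Admissible.memLp_rotatedGauged (hQ : Admissible D Q)
    (hΩ : ∀ i j, MemLp (fun x => Ω x i j) 2 volume) (i j : Fin N) :
    MemLp (fun x => rotatedGauged Ω Q x i j) 2 volume :=
  (hQ.memLp_matFracLaplacian j i).add (hQ.memLp_mul_transpose hΩ i j)

theorem aemeasurable_ofReal_sum_sq {A : EuclideanSpace ℝ (Fin n) → Matrix (Fin N) (Fin N) ℝ}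
    (hA : ∀ i j, MemLp (fun x => A x i j) 2 volume) :
    AEMeasurable (fun x => ENNReal.ofReal (∑ i, ∑ j, A x i j ^ 2)) volume :=
  (Finset.aemeasurable_fun_sum _ fun i _ => Finset.aemeasurable_fun_sum _ fun j _ =>
    (hA i j).aestronglyMeasurable.aemeasurable.pow_const 2).ennreal_ofReal

theorem matL2NormSq_eq_sum {A : EuclideanSpace ℝ (Fin n) → Matrix (Fin N) (Fin N) ℝ}
    (hA : ∀ i j, MemLp (fun x => A x i j) 2 volume) :
    matL2NormSq A = ENNReal.ofReal (∑ i, ∑ j, ‖(hA i j).toLp _‖ ^ 2) := by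
  have hm : ∀ i j, AEMeasurable (fun x => ENNReal.ofReal (A x i j ^ 2)) volume := fun i j =>
    ((hA i j).aestronglyMeasurable.aemeasurable.pow_const 2).ennreal_ofReal
  rw [ENNReal.ofReal_sum_of_nonneg fun i _ => Finset.sum_nonneg fun j _ => sq_nonneg _, matL2NormSq]
  have h1 : ∀ x, ENNReal.ofReal (∑ i, ∑ j, A x i j ^ 2) =
      ∑ i, ∑ j, ENNReal.ofReal (A x i j ^ 2) := fun x => by
    refine (ENNReal.ofReal_sum_of_nonneg fun i _ =>
      Finset.sum_nonneg fun j _ => sq_nonneg _).trans ?_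
    exact Finset.sum_congr rfl fun i _ => ENNReal.ofReal_sum_of_nonneg fun j _ => sq_nonneg _
  simp only [h1]
  rw [lintegral_finsetSum' _ fun i _ => Finset.aemeasurable_fun_sum _ fun j _ => hm i j]
  refine Finset.sum_congr rfl fun i _ => ?_
  rw [ENNReal.ofReal_sum_of_nonneg fun j _ => sq_nonneg _, lintegral_finsetSum' _ fun j _ => hm i j]
  exact Finset.sum_congr rfl fun j _ => (norm_sq_toLp_eq_lintegral (hA i j)).symm

/-- Pointwise a² ≤ 2(a + b)² + 2b², where b runs over the entries of Ω Qᵀ, whose Frobenius norm is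
that of Ω. -/
theorem Admissible.matL2NormSq_fracLaplacian_le (hQ : Admissible D Q)
    (hΩ : ∀ i j, MemLp (fun x => Ω x i j) 2 volume) :
    matL2NormSq (matFracLaplacian ((n : ℝ) / 2) (fun x => Q x - 1)) ≤
      2 * energy Ω Q + 2 * matL2NormSq Ω := by
  rw [hQ.energy_eq, matL2NormSq, matL2NormSq, matL2NormSq,
    ← lintegral_const_mul'' _ (aemeasurable_ofReal_sum_sq (hQ.memLp_rotatedGauged hΩ)),
    ← lintegral_const_mul'' _ (aemeasurable_ofReal_sum_sq hΩ),
    ← lintegral_add_right' _ ((aemeasurable_ofReal_sum_sq hΩ).const_mul _)]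
  refine lintegral_mono_ae ?_
  filter_upwards [hQ.mem_SO] with x hx
  have h2 : (2 : ℝ≥0∞) = ENNReal.ofReal 2 := by simp
  rw [h2, ← ENNReal.ofReal_mul zero_le_two, ← ENNReal.ofReal_mul zero_le_two,
    ← ENNReal.ofReal_add (by positivity) (by positivity), ← sum_sq_mul_transpose_right hx (Ω x),
    ← sum_sq_transpose (matFracLaplacian _ _ x)]
  refine ENNReal.ofReal_le_ofReal ?_
  simp only [Finset.mul_sum, ← Finset.sum_add_distrib]
  refine Finset.sum_le_sum fun i _ => Finset.sum_le_sum fun j _ => ?_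
  rw [rotatedGauged, Matrix.add_apply]
  set a := (matFracLaplacian ((n : ℝ) / 2) (fun x => Q x - 1) x).transpose i j
  -- The difference of the two sides is exactly (a + 2b)².
  nlinarith [sq_nonneg (a + 2 * (Ω x * (Q x).transpose) i j)]

theorem admissible_one (D : Set (EuclideanSpace ℝ (Fin n))) :
    Admissible D (fun _ => (1 : Matrix (Fin N) (Fin N) ℝ)) where
  memH i j := ⟨fun _ => 0, by simpa using hasFracLaplacian_zero _⟩
  support := Eventually.of_forall fun x _ => sub_self _
  mem_SO := Eventually.of_forall fun x => one_mem _

theorem energy_one (Ω : EuclideanSpace ℝ (Fin n) → Matrix (Fin N) (Fin N) ℝ) :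
    energy Ω (fun _ => 1) = matL2NormSq Ω := by
  -- The energy does not involve the domain, so any set serves here.
  rw [(admissible_one (∅ : Set (EuclideanSpace ℝ (Fin n)))).energy_eq]
  refine lintegral_congr_ae ?_
  have h0 : fracLaplacian ((n : ℝ) / 2) (fun _ : EuclideanSpace ℝ (Fin n) => (0 : ℝ)) =ᵐ[volume]
      fun _ => 0 :=
    (MemH.hasFracLaplacian ⟨_, hasFracLaplacian_zero _⟩).ae_unique (hasFracLaplacian_zero _)
  filter_upwards [h0] with x hx
  simp [rotatedGauged, matFracLaplacian, hx]

/-- Minimality against the constant map I gives E(P) ≤ ‖Ω‖²; coercivity then gives the factor 2 + 2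
= 4, whose square root is the constant. -/
theorem IsMinimizer.matL2Norm_fracLaplacian_le
    {P : EuclideanSpace ℝ (Fin n) → Matrix (Fin N) (Fin N) ℝ}
    (hΩ : ∀ i j, MemLp (fun x => Ω x i j) 2 volume) (hP : IsMinimizer D Ω P) :
    matL2Norm (matFracLaplacian ((n : ℝ) / 2) (fun x => P x - 1)) ≤ 2 * matL2Norm Ω := by
  have h1 : matL2NormSq (matFracLaplacian ((n : ℝ) / 2) (fun x => P x - 1)) ≤
      4 * matL2NormSq Ω := by
    have h2 := hP.2 _ (admissible_one D)
    rw [energy_one] at h2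
    calc _ ≤ 2 * energy Ω P + 2 * matL2NormSq Ω := hP.1.matL2NormSq_fracLaplacian_le hΩ
      _ ≤ 2 * matL2NormSq Ω + 2 * matL2NormSq Ω := by gcongr
      _ = 4 * matL2NormSq Ω := by ring
  have h4 : (4 : ℝ≥0∞) ^ (1 / 2 : ℝ) = 2 := by
    rw [show (4 : ℝ≥0∞) = 2 ^ (2 : ℝ) by norm_num, ← ENNReal.rpow_mul]
    norm_num
  calc _ ≤ (4 * matL2NormSq Ω) ^ (1 / 2 : ℝ) := ENNReal.rpow_le_rpow h1 (by norm_num)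
    _ = 2 * matL2Norm Ω := by rw [ENNReal.mul_rpow_of_nonneg _ _ (by norm_num), h4, matL2Norm]

end Energy

/-! ### Compactness of the admissible class, lower semicontinuity, and existence. -/

section Existence

variable {n N : ℕ} {D : Set (EuclideanSpace ℝ (Fin n))}
  {Ω : EuclideanSpace ℝ (Fin n) → Matrix (Fin N) (Fin N) ℝ}

theorem Admissible.memLp_sub_one {Q : EuclideanSpace ℝ (Fin n) → Matrix (Fin N) (Fin N) ℝ}
    (hQ : Admissible D Q) (i j : Fin N) : MemLp (fun x => (Q x - 1) i j) 2 volume :=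
  (hQ.memH i j).hasFracLaplacian.1

/-- Entries of Q and of I are at most 1 in absolute value, so their difference is at most 2 and
lives on a set of finite measure. No Poincaré inequality is needed. -/
theorem Admissible.norm_toLp_sub_one_le
    {Q : EuclideanSpace ℝ (Fin n) → Matrix (Fin N) (Fin N) ℝ} (hQ : Admissible D Q)
    (hfin : volume (closure D) ≠ ∞) (i j : Fin N) :
    ‖(hQ.memLp_sub_one i j).toLp _‖ ≤
      ‖indicatorConstLp 2 isClosed_closure.measurableSet hfin (2 : ℝ)‖ := by
  refine Lp.norm_le_norm_of_ae_le ?_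
  filter_upwards [(hQ.memLp_sub_one i j).coeFn_toLp, hQ.support, hQ.mem_SO,
    indicatorConstLp_coeFn (p := 2) (hs := isClosed_closure.measurableSet) (hμs := hfin)
      (c := (2 : ℝ))] with x h1 h2 h3 h4
  rw [h1, h4]
  by_cases hx : x ∈ closure D
  · rw [Set.indicator_of_mem hx, Matrix.sub_apply]
    have ha := abs_entry_le_one h3 i j
    have hb := abs_entry_le_one (one_mem (Matrix.specialOrthogonalGroup (Fin N) ℝ)) i j
    refine (norm_sub_le _ _).trans ?_
    rw [Real.norm_eq_abs, Real.norm_eq_abs, Real.norm_eq_abs, abs_two]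
    linarith
  · rw [h2 hx, Matrix.zero_apply, norm_zero]
    exact norm_nonneg _

theorem Admissible.norm_toLp_matFracLaplacian_le
    {Q : EuclideanSpace ℝ (Fin n) → Matrix (Fin N) (Fin N) ℝ} (hQ : Admissible D Q) {C : ℝ}
    (hC0 : 0 ≤ C)
    (hC : matL2NormSq (matFracLaplacian ((n : ℝ) / 2) (fun x => Q x - 1)) ≤ ENNReal.ofReal C)
    (i j : Fin N) : ‖(hQ.memLp_matFracLaplacian i j).toLp _‖ ≤ √C := by
  rw [matL2NormSq_eq_sum hQ.memLp_matFracLaplacian, ENNReal.ofReal_le_ofReal_iff hC0] at hC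
  refine Real.le_sqrt_of_sq_le (le_trans ?_ hC)
  have h1 := Finset.single_le_sum
    (f := fun j => ‖(hQ.memLp_matFracLaplacian i j).toLp _‖ ^ 2) (fun j _ => sq_nonneg _)
    (Finset.mem_univ j)
  have h2 := Finset.single_le_sum
    (f := fun i => ∑ j, ‖(hQ.memLp_matFracLaplacian i j).toLp _‖ ^ 2)
    (fun i _ => Finset.sum_nonneg fun j _ => sq_nonneg _) (Finset.mem_univ i)
  exact h1.trans h2

/-- Sequential compactness of the admissible class on sublevels of `‖Δ^{n/4}(Q - I)‖₂`. -/
theorem exists_subseq_admissible (hn : 1 ≤ n) (hD : Bornology.IsBounded D)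
    {Q : ℕ → EuclideanSpace ℝ (Fin n) → Matrix (Fin N) (Fin N) ℝ}
    (hQ : ∀ k, Admissible D (Q k)) {C : ℝ} (hC0 : 0 ≤ C)
    (hC : ∀ k, matL2NormSq (matFracLaplacian ((n : ℝ) / 2) (fun x => Q k x - 1)) ≤
      ENNReal.ofReal C) :
    ∃ (P : EuclideanSpace ℝ (Fin n) → Matrix (Fin N) (Fin N) ℝ) (hP : Admissible D P)
      (φ : ℕ → ℕ), StrictMono φ ∧
      (∀ᵐ x, Tendsto (fun k => Q (φ k) x) atTop (𝓝 (P x))) ∧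
      ∀ i j h, Tendsto (fun k => ⟪h, ((hQ (φ k)).memLp_matFracLaplacian i j).toLp _⟫_ℝ) atTop
        (𝓝 ⟪h, (hP.memLp_matFracLaplacian i j).toLp _⟫_ℝ) := by
  have hfin : volume (closure D) ≠ ∞ := hD.isCompact_closure.measure_lt_top.ne
  have hmeas : MeasurableSet (closure D) := isClosed_closure.measurableSet
  have hs : (0 : ℝ) < (n : ℝ) / 2 := by
    have : (0 : ℝ) < n := by exact_mod_cast hn
    positivity
  set F : Fin N × Fin N → ℕ → Lp (α := EuclideanSpace ℝ (Fin n)) ℝ 2 volume :=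
    fun p k => ((hQ k).memLp_sub_one p.1 p.2).toLp _ with hF
  set G : Fin N × Fin N → ℕ → Lp (α := EuclideanSpace ℝ (Fin n)) ℝ 2 volume :=
    fun p k => ((hQ k).memLp_matFracLaplacian p.1 p.2).toLp _
  have hFG : ∀ p k, IsFourierMultiple ((n : ℝ) / 2) (complexify n (F p k))
      (complexify n (G p k)) := fun p k =>
    (hasFracLaplacian_iff ((hQ k).memLp_sub_one p.1 p.2)
      ((hQ k).memLp_matFracLaplacian p.1 p.2)).1 ((hQ k).memH p.1 p.2).hasFracLaplacian
  have hsupp : ∀ p k, ∀ᵐ x, x ∉ closure D → F p k x = 0 := by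
    intro p k
    filter_upwards [((hQ k).memLp_sub_one p.1 p.2).coeFn_toLp, (hQ k).support] with x h1 h2 hx
    rw [hF, h1, h2 hx, Matrix.zero_apply]
  -- One subsequence must serve all entries; the property survives further extraction, so finitely
  -- many successive choices suffice.
  obtain ⟨φ, hφ, hlim⟩ := exists_subseq_forall_of_finite
    (fun (p : Fin N × Fin N) (φ : ℕ → ℕ) =>
      ∃ f' g' : Lp (α := EuclideanSpace ℝ (Fin n)) ℝ 2 volume,
        IsFourierMultiple ((n : ℝ) / 2) (complexify n f') (complexify n g') ∧
        (∀ᵐ x, Tendsto (fun k => F p (φ k) x) atTop (𝓝 (f' x))) ∧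
        ∀ h, Tendsto (fun k => ⟪h, G p (φ k)⟫_ℝ) atTop (𝓝 ⟪h, g'⟫_ℝ))
    (by
      intro p φ _
      obtain ⟨f', g', ψ, hψ, h1, h2, h3⟩ := exists_subseq_fracGraph hs hmeas hfin
        (fun k => F p (φ k)) (fun k => G p (φ k))
        (fun k => (hQ (φ k)).norm_toLp_sub_one_le hfin p.1 p.2)
        (fun k => (hQ (φ k)).norm_toLp_matFracLaplacian_le hC0 (hC _) p.1 p.2)
        (fun k => hsupp p (φ k)) (fun k => hFG p (φ k))
      exact ⟨ψ, hψ, f', g', h1, h2, h3⟩)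
    (by
      rintro p φ ψ ⟨f', g', h1, h2, h3⟩ hψ
      exact ⟨f', g', h1, h2.mono fun x hx => hx.comp hψ.tendsto_atTop,
        fun h => (h3 h).comp hψ.tendsto_atTop⟩)
  choose f' g' h1 h2 h3 using hlim
  set P : EuclideanSpace ℝ (Fin n) → Matrix (Fin N) (Fin N) ℝ :=
    fun x => 1 + Matrix.of fun i j => f' (i, j) x with hPdef
  have hPsub : ∀ i j, (fun x => (P x - 1) i j) = f' (i, j) := by
    intro i j
    funext x
    simp [hPdef]
  have hPlap : ∀ i j, HasFracLaplacian ((n : ℝ) / 2) (fun x => (P x - 1) i j) (g' (i, j)) := by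
    intro i j
    rw [hPsub]
    exact hasFracLaplacian_of_mem_fracGraph (h1 (i, j))
  have hae : ∀ᵐ x, Tendsto (fun k => Q (φ k) x) atTop (𝓝 (P x)) := by
    have hF' : ∀ (p : Fin N × Fin N) (k : ℕ), ∀ᵐ x, F p (φ k) x = (Q (φ k) x - 1) p.1 p.2 :=
      fun p k => ((hQ (φ k)).memLp_sub_one p.1 p.2).coeFn_toLp
    filter_upwards [ae_all_iff.2 h2, ae_all_iff.2 fun p => ae_all_iff.2 (hF' p)] with x hx hc
    refine tendsto_pi_nhds.2 fun i => tendsto_pi_nhds.2 fun j => ?_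
    have hij := (hx (i, j)).const_add ((1 : Matrix (Fin N) (Fin N) ℝ) i j)
    refine (hij.congr fun k => ?_)
    rw [hc (i, j) k]
    simp
  have hP : Admissible D P := by
    refine ⟨fun i j => ⟨_, hPlap i j⟩, ?_, ?_⟩
    · filter_upwards [hae, ae_all_iff.2 fun k => (hQ (φ k)).support] with x hx hsx hxD
      refine tendsto_nhds_unique (hx.sub_const 1) ?_
      simp [hsx _ hxD]
    · filter_upwards [hae, ae_all_iff.2 fun k => (hQ (φ k)).mem_SO] with x hx hso
      exact isClosed_specialOrthogonalGroup.mem_of_tendsto hx (Eventually.of_forall hso)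
  refine ⟨P, hP, φ, hφ, hae, fun i j h => ?_⟩
  have heq : (hP.memLp_matFracLaplacian i j).toLp _ = g' (i, j) := by
    apply Lp.ext
    exact (hP.memLp_matFracLaplacian i j).coeFn_toLp.trans
      ((hP.memH i j).hasFracLaplacian.ae_unique (hPlap i j))
  rw [heq]
  exact h3 (i, j) h

/-- Lower semicontinuity of the energy. -/
theorem toReal_energy_le_of_tendsto (hΩ : ∀ i j, MemLp (fun x => Ω x i j) 2 volume)
    {Q : ℕ → EuclideanSpace ℝ (Fin n) → Matrix (Fin N) (Fin N) ℝ}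
    {P : EuclideanSpace ℝ (Fin n) → Matrix (Fin N) (Fin N) ℝ}
    (hQ : ∀ k, Admissible D (Q k)) (hP : Admissible D P)
    (hae : ∀ᵐ x, Tendsto (fun k => Q k x) atTop (𝓝 (P x)))
    (hweak : ∀ i j h, Tendsto (fun k => ⟪h, ((hQ k).memLp_matFracLaplacian i j).toLp _⟫_ℝ) atTop
        (𝓝 ⟪h, (hP.memLp_matFracLaplacian i j).toLp _⟫_ℝ)) {b : ℕ → ℝ} {e : ℝ}
    (hb : ∀ k, (energy Ω (Q k)).toReal ≤ b k) (hbe : Tendsto b atTop (𝓝 e)) :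
    (energy Ω P).toReal ≤ e := by
  have hE : ∀ {R : EuclideanSpace ℝ (Fin n) → Matrix (Fin N) (Fin N) ℝ} (hR : Admissible D R),
      (energy Ω R).toReal = ∑ i, ∑ j, ‖(hR.memLp_rotatedGauged hΩ i j).toLp _‖ ^ 2 := by
    intro R hR
    rw [hR.energy_eq, matL2NormSq_eq_sum (hR.memLp_rotatedGauged hΩ), ENNReal.toReal_ofReal]
    exact Finset.sum_nonneg fun i _ => Finset.sum_nonneg fun j _ => sq_nonneg _
  have hprod : ∀ i j (h : Lp (α := EuclideanSpace ℝ (Fin n)) ℝ 2 volume),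
      Tendsto (fun k => ⟪h, ((hQ k).memLp_mul_transpose hΩ i j).toLp _⟫_ℝ) atTop
        (𝓝 ⟪h, (hP.memLp_mul_transpose hΩ i j).toLp _⟫_ℝ) := by
    intro i j h
    refine tendsto_inner_toLp_of_dominated (b := fun x => ∑ l, ‖Ω x i l‖) _ _
      (memLp_finsetSum _ fun l _ => (hΩ i l).norm) (fun k => ?_) ?_ h
    · filter_upwards [(hQ k).mem_SO] with x hx
      rw [Matrix.mul_apply]
      refine (Finset.abs_sum_le_sum_abs _ _).trans (Finset.sum_le_sum fun l _ => ?_)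
      rw [abs_mul]
      exact mul_le_of_le_one_right (abs_nonneg _) (abs_entry_le_one hx j l)
    · filter_upwards [hae] with x hx
      have hc : Continuous fun A : Matrix (Fin N) (Fin N) ℝ => (Ω x * A.transpose) i j := by
        fun_prop
      exact (hc.tendsto _).comp hx
  have hinner : ∀ i j (h : Lp (α := EuclideanSpace ℝ (Fin n)) ℝ 2 volume),
      Tendsto (fun k => ⟪h, ((hQ k).memLp_rotatedGauged hΩ i j).toLp _⟫_ℝ) atTop
        (𝓝 ⟪h, (hP.memLp_rotatedGauged hΩ i j).toLp _⟫_ℝ) := by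
    intro i j h
    have hadd : ∀ {R : EuclideanSpace ℝ (Fin n) → Matrix (Fin N) (Fin N) ℝ}
        (hR : Admissible D R), ⟪h, (hR.memLp_rotatedGauged hΩ i j).toLp _⟫_ℝ =
          ⟪h, (hR.memLp_matFracLaplacian j i).toLp _⟫_ℝ +
            ⟪h, (hR.memLp_mul_transpose hΩ i j).toLp _⟫_ℝ := by
      intro R hR
      rw [← inner_add_right, ← MemLp.toLp_add]
      rfl
    rw [hadd hP]
    exact ((hweak j i h).add (hprod i j h)).congr fun k => (hadd (hQ k)).symm
  rw [hE hP]
  -- With v the limit, 2⟪v, v_k⟫ - ‖v‖² is at most ‖v_k‖² and tends to ‖v‖² under weak convergence.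
  have hlim : Tendsto (fun k => ∑ i, ∑ j,
      (2 * ⟪(hP.memLp_rotatedGauged hΩ i j).toLp _,
        ((hQ k).memLp_rotatedGauged hΩ i j).toLp _⟫_ℝ
        - ‖(hP.memLp_rotatedGauged hΩ i j).toLp _‖ ^ 2)) atTop
      (𝓝 (∑ i, ∑ j, ‖(hP.memLp_rotatedGauged hΩ i j).toLp _‖ ^ 2)) := by
    refine tendsto_finsetSum _ fun i _ => tendsto_finsetSum _ fun j _ => ?_
    have h := ((hinner i j ((hP.memLp_rotatedGauged hΩ i j).toLp _)).const_mul 2).sub_const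
      (‖(hP.memLp_rotatedGauged hΩ i j).toLp _‖ ^ 2)
    rw [real_inner_self_eq_norm_sq] at h
    convert h using 2
    ring
  refine le_of_tendsto_of_tendsto' hlim hbe fun k => le_trans ?_ (hb k)
  rw [hE (hQ k)]
  refine Finset.sum_le_sum fun i _ => Finset.sum_le_sum fun j _ => ?_
  have h := norm_sub_sq_real ((hP.memLp_rotatedGauged hΩ i j).toLp _)
    (((hQ k).memLp_rotatedGauged hΩ i j).toLp _)
  have h0 := sq_nonneg ‖(hP.memLp_rotatedGauged hΩ i j).toLp _ -
    ((hQ k).memLp_rotatedGauged hΩ i j).toLp _‖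
  linarith

theorem Admissible.energy_ne_top {Q : EuclideanSpace ℝ (Fin n) → Matrix (Fin N) (Fin N) ℝ}
    (hQ : Admissible D Q) (hΩ : ∀ i j, MemLp (fun x => Ω x i j) 2 volume) : energy Ω Q ≠ ∞ := by
  rw [hQ.energy_eq, matL2NormSq_eq_sum (hQ.memLp_rotatedGauged hΩ)]
  exact ENNReal.ofReal_ne_top

theorem exists_isMinimizer (hn : 1 ≤ n) (hD : Bornology.IsBounded D)
    (hΩ : ∀ i j, MemLp (fun x => Ω x i j) 2 volume) : ∃ P, IsMinimizer D Ω P := by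
  set S : Set ℝ := {r | ∃ Q, Admissible D Q ∧ (energy Ω Q).toReal = r} with hS
  have hne : S.Nonempty := ⟨_, _, admissible_one D, rfl⟩
  have hbdd : BddBelow S := ⟨0, by rintro _ ⟨Q, -, rfl⟩; exact ENNReal.toReal_nonneg⟩
  have hex : ∀ k : ℕ, ∃ Q, Admissible D Q ∧ (energy Ω Q).toReal < sInf S + 1 / ((k : ℝ) + 1) := by
    intro k
    obtain ⟨_, ⟨Q, hQ, rfl⟩, hlt⟩ := exists_lt_of_csInf_lt hne
      (lt_add_of_pos_right (sInf S) (by positivity : (0 : ℝ) < 1 / ((k : ℝ) + 1)))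
    exact ⟨Q, hQ, hlt⟩
  choose Q hQ hlt using hex
  have hΩfin : matL2NormSq Ω ≠ ∞ := by
    rw [matL2NormSq_eq_sum hΩ]
    exact ENNReal.ofReal_ne_top
  -- The energies stay below `sInf S + 1`, since 1/(k + 1) ≤ 1; the absolute value makes the
  -- constant visibly nonnegative.
  have hbound : ∀ k, matL2NormSq (matFracLaplacian ((n : ℝ) / 2) (fun x => Q k x - 1)) ≤
      ENNReal.ofReal (2 * |sInf S + 1| + 2 * (matL2NormSq Ω).toReal) := by
    intro k
    refine ((hQ k).matL2NormSq_fracLaplacian_le hΩ).trans ?_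
    rw [ENNReal.ofReal_add (by positivity) (by positivity), ENNReal.ofReal_mul zero_le_two,
      ENNReal.ofReal_mul zero_le_two, ENNReal.ofReal_toReal hΩfin, ENNReal.ofReal_ofNat]
    gcongr
    rw [← ENNReal.ofReal_toReal ((hQ k).energy_ne_top hΩ)]
    refine ENNReal.ofReal_le_ofReal ((hlt k).le.trans (le_trans ?_ (le_abs_self _)))
    have : 1 / ((k : ℝ) + 1) ≤ 1 := by
      rw [div_le_one (by positivity)]
      linarith [k.cast_nonneg (α := ℝ)]
    linarith
  obtain ⟨P, hP, φ, hφ, hae, hweak⟩ := exists_subseq_admissible hn hD hQ (by positivity) hbound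
  have hmin : (energy Ω P).toReal ≤ sInf S := by
    refine toReal_energy_le_of_tendsto hΩ (fun k => hQ (φ k)) hP hae hweak
      (fun k => (hlt (φ k)).le) ?_
    have h0 := (tendsto_one_div_add_atTop_nhds_zero_nat (𝕜 := ℝ)).comp hφ.tendsto_atTop
    simpa using h0.const_add (sInf S)
  refine ⟨P, hP, fun R hR => ?_⟩
  rw [← ENNReal.toReal_le_toReal (hP.energy_ne_top hΩ) (hR.energy_ne_top hΩ)]
  exact hmin.trans (csInf_le hbdd ⟨R, hR, rfl⟩)

end Existence

end FracGauge

theorem mainTheorem7 (n N : ℕ) (hn : 1 ≤ n)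
    (D : Set (EuclideanSpace ℝ (Fin n))) (hD : Bornology.IsBounded D)
    (Ω : EuclideanSpace ℝ (Fin n) → Matrix (Fin N) (Fin N) ℝ)
    (hΩ : ∀ i j, MeasureTheory.MemLp (fun x => Ω x i j) 2 MeasureTheory.volume) :
    (∃ P : EuclideanSpace ℝ (Fin n) → Matrix (Fin N) (Fin N) ℝ,
      FracGauge.IsMinimizer D Ω P) ∧
    (∀ P : EuclideanSpace ℝ (Fin n) → Matrix (Fin N) (Fin N) ℝ,
      FracGauge.IsMinimizer D Ω P →
        FracGauge.matL2Norm (FracGauge.matFracLaplacian ((n : ℝ) / 2) (fun x => P x - 1)) ≤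
          2 * FracGauge.matL2Norm Ω) :=
  ⟨FracGauge.exists_isMinimizer hn hD hΩ, fun _ hP => hP.matL2Norm_fracLaplacian_le hΩ⟩
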